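/- Let $\mathcal H=\bigoplus_{n\ge 0}\mathcal H_n$ be a connected graded Hopf algebra over $\mathbb C$: the product, the coproduct $\Delta$ and the antipode respect the grading, i.e. $\mathcal H_p\mathcal H_q\subset\mathcal H_{p+q}$, $\Delta(\mathcal H_n)\subset\bigoplus_{p+q=n}\mathcal H_p\otimes\mathcal H_q$, $S(\mathcal H_n)\subset\mathcal H_n$, and $\dim\mathcal H_0=1$. Let $\varepsilon$ be its counit and let $Y:\mathcal H\to\mathcal H$ be the linear map with $Y(x)=nx$ for $x\in\mathcal H_n$. Let $\mathcal A$ be the algebra of germs at $0\in\mathbb C$ of meromorphic functions of $z$, $\mathcal A_+$ the subalgebra of germs of functions holomorphic at $0$, and $\mathcal A_-=z^{-1}\mathbb C[z^{-1}]$, so that $\mathcal A=\mathcal A_+\oplus\mathcal A_-$. On the space $\mathcal L(\mathcal H,\mathcal A)$ of linear maps consider the convolution product $\varphi*\psi=m_{\mathcal A}\circ(\varphi\otimes\psi)\circ\Delta$, and put $$G=\{\varphi\in\mathcal L(\mathcal H,\mathcal A):\varphi(\mathbf 1)=1\},\qquad \mathfrak g=\{\alpha\in\mathcal L(\mathcal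 H,\mathcal A):\alpha(\mathbf 1)=0\};$$ $G$ is a group for $*$. For $\varphi\in G$ let $\widetilde R(\varphi)$ be the unique $\gamma\in\mathfrak g$ with $\varphi\circ Y=\varphi*\gamma$. Every $\varphi\in G$ has a unique Birkhoff decomposition $\varphi=\varphi_-^{*-1}*\varphi_+$, where the polar part $\varphi_-\in G$ maps $\operatorname{Ker}\varepsilon$ into $\mathcal A_-$ and $\varphi_+$ maps $\mathcal H$ into $\mathcal A_+$. For $\psi\in G$ and $t\in\mathbb C$ let $\psi^t\in G$ be the linear map with $\psi^t(x)(z)=e^{tzn}\,\psi(x)(z)$ for all $x\in\mathcal H_n$, $n\ge 0$, and let $G^\Phi$ be the set of all $\psi\in G$ for which the polar part $(\psi^t)_-$ does not depend on $t$. For $\psi\in\mathcal L(\mathcal H,\mathcal A)$ let $z\psi$ be the map $(z\psi)(x)(z)=z\cdot\psi(x)(z)$. Theorem. The map $z\widetilde R:G\to\mathfrak g$, $\psi\mapsto z\widetilde R(\psi)$, restricts to a bijection from $G^\Phi$ onto $\mathfrak g\cap\mathcal L(\mathcal H,\mathcal A_+)$. -/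

import Mathlib

open scoped TensorProduct Topology
open Filter Coalgebra

namespace Renorm

noncomputable section

/-! ### Germs of meromorphic functions at `0` -/

/-- The `ℂ`-algebra structure on germs at `0` of functions on a pointed neighbourhood of `0`
(pointwise operations). -/
instance germAlgebra : Algebra ℂ (Germ (𝓝[≠] (0 : ℂ)) ℂ) :=
  Algebra.ofModule
    (fun r x y => by
      induction x using Germ.inductionOn with | _ f =>
      induction y using Germ.inductionOn with | _ g =>
      exact congrArg (fun h : ℂ → ℂ => (h : Germ (𝓝[≠] (0 : ℂ)) ℂ)) (smul_mul_assoc r f g))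
    (fun r x y => by
      induction x using Germ.inductionOn with | _ f =>
      induction y using Germ.inductionOn with | _ g =>
      exact congrArg (fun h : ℂ → ℂ => (h : Germ (𝓝[≠] (0 : ℂ)) ℂ)) (mul_smul_comm r f g))

/-- The algebra of germs at `0` of meromorphic functions, inside the germs along the pointed
neighbourhoods of `0`. -/
def meroSubalgebra : Subalgebra ℂ (Germ (𝓝[≠] (0 : ℂ)) ℂ) where
  carrier := {a | ∃ f : ℂ → ℂ, MeromorphicAt f 0 ∧ a = ↑f}
  mul_mem' := by
    rintro _ _ ⟨f, hf, rfl⟩ ⟨g, hg, rfl⟩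
    exact ⟨f * g, hf.mul hg, rfl⟩
  add_mem' := by
    rintro _ _ ⟨f, hf, rfl⟩ ⟨g, hg, rfl⟩
    exact ⟨f + g, hf.add hg, rfl⟩
  algebraMap_mem' r := by
    refine ⟨fun _ => r, MeromorphicAt.const r 0, ?_⟩
    rw [Algebra.algebraMap_eq_smul_one]
    exact congrArg (fun h : ℂ → ℂ => (h : Germ (𝓝[≠] (0 : ℂ)) ℂ))
      (funext fun z => by simp : (r • (1 : ℂ → ℂ)) = fun _ => r)

/-- `𝒜`: germs of meromorphic functions at `0`. -/
def MeroGerm : Type := meroSubalgebra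

instance : CommRing MeroGerm := inferInstanceAs (CommRing meroSubalgebra)

instance : Algebra ℂ MeroGerm := inferInstanceAs (Algebra ℂ meroSubalgebra)

/-- The germ at `0` of a function that is meromorphic at `0`. -/
def germOf (f : ℂ → ℂ) (hf : MeromorphicAt f 0) : MeroGerm :=
  ⟨(f : Germ (𝓝[≠] (0 : ℂ)) ℂ), f, hf, rfl⟩

/-- `𝒜₊`: germs of functions that are holomorphic at `0`. -/
def holoAlg : Subalgebra ℂ MeroGerm where
  carrier := {a | ∃ f : ℂ → ℂ, ∃ hf : AnalyticAt ℂ f 0, a = germOf f hf.meromorphicAt}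
  mul_mem' := by
    rintro _ _ ⟨f, hf, rfl⟩ ⟨g, hg, rfl⟩
    exact ⟨f * g, hf.mul hg, rfl⟩
  add_mem' := by
    rintro _ _ ⟨f, hf, rfl⟩ ⟨g, hg, rfl⟩
    exact ⟨f + g, hf.add hg, rfl⟩
  algebraMap_mem' r := by
    refine ⟨fun _ => r, analyticAt_const, ?_⟩
    rw [Algebra.algebraMap_eq_smul_one]
    exact Subtype.ext (congrArg (fun h : ℂ → ℂ => (h : Germ (𝓝[≠] (0 : ℂ)) ℂ))
      (funext fun z => by simp : (r • (1 : ℂ → ℂ)) = fun _ => r))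

theorem meromorphicAt_polar (p : Polynomial ℂ) :
    MeromorphicAt (fun z : ℂ => z⁻¹ * p.eval z⁻¹) 0 := by
  have hinv : MeromorphicAt (fun z : ℂ => z⁻¹) 0 := (MeromorphicAt.id (0 : ℂ)).inv
  refine hinv.mul ?_
  induction p using Polynomial.induction_on' with
  | add p q hp hq =>
    simp only [Polynomial.eval_add]
    exact hp.add hq
  | monomial n a =>
    simp only [Polynomial.eval_monomial]
    exact (MeromorphicAt.const a (0 : ℂ)).mul (hinv.pow n)

/-- `𝒜₋ = z⁻¹ ℂ[z⁻¹]`. -/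
def polarAlg : NonUnitalSubalgebra ℂ MeroGerm where
  carrier := {a | ∃ p : Polynomial ℂ, a = germOf _ (meromorphicAt_polar p)}
  mul_mem' := by
    rintro _ _ ⟨p, rfl⟩ ⟨q, rfl⟩
    refine ⟨Polynomial.X * p * q, Subtype.ext ?_⟩
    refine congrArg (fun h : ℂ → ℂ => (h : Germ (𝓝[≠] (0 : ℂ)) ℂ)) (funext fun z => ?_)
    simp only [Polynomial.eval_mul, Polynomial.eval_X]
    change z⁻¹ * p.eval z⁻¹ * (z⁻¹ * q.eval z⁻¹) = _
    ring
  add_mem' := by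
    rintro _ _ ⟨p, rfl⟩ ⟨q, rfl⟩
    refine ⟨p + q, Subtype.ext ?_⟩
    refine congrArg (fun h : ℂ → ℂ => (h : Germ (𝓝[≠] (0 : ℂ)) ℂ)) (funext fun z => ?_)
    simp only [Polynomial.eval_add]
    change z⁻¹ * p.eval z⁻¹ + z⁻¹ * q.eval z⁻¹ = _
    ring
  zero_mem' := by
    refine ⟨0, Subtype.ext ?_⟩
    refine congrArg (fun h : ℂ → ℂ => (h : Germ (𝓝[≠] (0 : ℂ)) ℂ)) (funext fun z => ?_)
    simp
  smul_mem' := by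
    rintro c _ ⟨p, rfl⟩
    refine ⟨Polynomial.C c * p, Subtype.ext ?_⟩
    refine congrArg (fun h : ℂ → ℂ => (h : Germ (𝓝[≠] (0 : ℂ)) ℂ)) (funext fun z => ?_)
    simp only [Polynomial.eval_mul, Polynomial.eval_C]
    change c * (z⁻¹ * p.eval z⁻¹) = _
    ring

/-- The germ of `z ↦ z`. -/
def zGerm : MeroGerm := germOf (fun z => z) (MeromorphicAt.id 0)

theorem analyticAt_exp_mul (t : ℂ) (n : ℕ) :
    AnalyticAt ℂ (fun z : ℂ => Complex.exp (t * z * n)) 0 := by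
  fun_prop

/-- The germ of `z ↦ exp (t z n)`. -/
def expGerm (t : ℂ) (n : ℕ) : MeroGerm :=
  germOf (fun z => Complex.exp (t * z * n)) (analyticAt_exp_mul t n).meromorphicAt

/-! ### Connected graded Hopf algebras -/

section Hopf

variable {H : Type*} [Ring H] [HopfAlgebra ℂ H]

/-- A graded algebra `H = ⨁ₙ 𝓗 n` whose Hopf structure is compatible with the grading, and which
is connected: `𝓗 0` is one-dimensional. -/
class ConnectedGradedHopf (𝓗 : ℕ → Submodule ℂ H) [GradedAlgebra 𝓗] : Prop where
  comul_mem : ∀ n, ∀ x ∈ 𝓗 n, comul (R := ℂ) x ∈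
    ⨆ (p : ℕ × ℕ) (_ : p.1 + p.2 = n),
      LinearMap.range (TensorProduct.map (𝓗 p.1).subtype (𝓗 p.2).subtype)
  antipode_mem : ∀ n, ∀ x ∈ 𝓗 n, HopfAlgebra.antipode ℂ x ∈ 𝓗 n
  connected : Module.finrank ℂ (𝓗 0) = 1

variable (H) in
/-- `ℒ(H, 𝒜)`: all linear maps `H → 𝒜`. The ring structure of `WithConv` is the one with the
convolution product, whose unit is `x ↦ ε(x) 1`. -/
abbrev LinMaps : Type _ := WithConv (H →ₗ[ℂ] MeroGerm)

variable (H) in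
/-- `G`: the maps that send `1` to `1`. -/
def G : Set (LinMaps H) := {φ | φ 1 = 1}

variable (H) in
/-- `𝔤`: the maps that send `1` to `0`. -/
def lieG : Set (LinMaps H) := {α | α 1 = 0}

variable (H) in
/-- `ℒ(H, 𝒜₊)`: the maps with values in `𝒜₊`. -/
def holoMaps : Set (LinMaps H) := {α | ∀ x, α x ∈ holoAlg}

/-- The linear map on `H` that restricts to `f n` on the `n`-th homogeneous component. -/
def gradedLift {M : Type*} [AddCommGroup M] [Module ℂ M] (𝓗 : ℕ → Submodule ℂ H)
    [GradedAlgebra 𝓗] (f : ℕ → H →ₗ[ℂ] M) : H →ₗ[ℂ] M :=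
  DirectSum.toModule ℂ ℕ M (fun n => f n ∘ₗ (𝓗 n).subtype) ∘ₗ
    (DirectSum.decomposeLinearEquiv 𝓗).toLinearMap

theorem gradedLift_apply {M : Type*} [AddCommGroup M] [Module ℂ M] (𝓗 : ℕ → Submodule ℂ H)
    [GradedAlgebra 𝓗] (f : ℕ → H →ₗ[ℂ] M) {n : ℕ} {x : H} (hx : x ∈ 𝓗 n) :
    gradedLift 𝓗 f x = f n x := by
  lift x to 𝓗 n using hx
  simp only [gradedLift, LinearMap.comp_apply, LinearEquiv.coe_coe,
    DirectSum.decomposeLinearEquiv_apply, DirectSum.decompose_coe]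
  exact DirectSum.toModule_lof ℂ (M := fun i => 𝓗 i) n x

/-- The grading biderivation `Y`: multiplication by `n` on `𝓗 n`. -/
def gradY (𝓗 : ℕ → Submodule ℂ H) [GradedAlgebra 𝓗] : H →ₗ[ℂ] H :=
  gradedLift 𝓗 fun n => (n : ℂ) • LinearMap.id

/-- `φ ∘ Y`. -/
def compY (𝓗 : ℕ → Submodule ℂ H) [GradedAlgebra 𝓗] (φ : LinMaps H) : LinMaps H :=
  WithConv.toConv (φ.ofConv ∘ₗ gradY 𝓗)

/-- `ψᵗ`: the map given by `ψᵗ(x)(z) = exp (t z |x|) ψ(x)(z)` on homogeneous `x`. -/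
def twist (𝓗 : ℕ → Submodule ℂ H) [GradedAlgebra 𝓗] (t : ℂ) (ψ : LinMaps H) : LinMaps H :=
  WithConv.toConv (gradedLift 𝓗 fun n => expGerm t n • ψ.ofConv)

/-- `(φ₋, φ₊)` is the Birkhoff decomposition `φ = φ₋⁻¹ * φ₊` of `φ`: the polar part `φ₋` sends `1`
to `1` and the kernel of the counit into `𝒜₋`, and `φ₊` has values in `𝒜₊`. The inverse is the one
for the convolution product. -/
def IsBirkhoff (φ φm φp : LinMaps H) : Prop :=
  φm ∈ G H ∧ (∀ x, counit (R := ℂ) x = 0 → φm x ∈ polarAlg) ∧ φp ∈ holoMaps H ∧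
    φ = Ring.inverse φm * φp

/-- `G^Φ`: the elements `ψ` of `G` for which the polar part of `ψᵗ` does not depend on `t`. -/
def GPhi (𝓗 : ℕ → Submodule ℂ H) [GradedAlgebra 𝓗] : Set (LinMaps H) :=
  {ψ | ψ ∈ G H ∧ ∃ φm : LinMaps H, ∀ t : ℂ, ∃ φp : LinMaps H, IsBirkhoff (twist 𝓗 t ψ) φm φp}

/-! ### The map `R̃` -/

theorem mem_G_iff_sub {φ : LinMaps H} : φ ∈ G H ↔ (1 : LinMaps H) - φ ∈ lieG H := by
  have h : (1 - φ) (1 : H) = (1 : MeroGerm) - φ 1 := by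
    change (1 : LinMaps H) 1 - φ 1 = _
    simp
  change φ 1 = 1 ↔ (1 - φ) 1 = 0
  rw [h, sub_eq_zero, eq_comm]

theorem mul_apply_one (φ ψ : LinMaps H) : (φ * ψ) 1 = φ 1 * ψ 1 := by
  simp [LinearMap.convMul_apply, Algebra.TensorProduct.one_def]

/-- The decreasing filtration: maps that vanish in all degrees `< N`. -/
def van (𝓗 : ℕ → Submodule ℂ H) (N : ℕ) : Submodule ℂ (LinMaps H) where
  carrier := {α | ∀ n < N, ∀ x ∈ 𝓗 n, α x = 0}
  add_mem' := by
    intro a b ha hb n hn x hx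
    change a x + b x = 0
    rw [ha n hn x hx, hb n hn x hx, add_zero]
  zero_mem' := fun _ _ _ _ => rfl
  smul_mem' := by
    intro c a ha n hn x hx
    change c • a x = 0
    rw [ha n hn x hx, smul_zero]

theorem eq_zero_of_mem_van (𝓗 : ℕ → Submodule ℂ H) [GradedAlgebra 𝓗] {α : LinMaps H} (h : ∀ N, α ∈ van 𝓗 N) : α = 0 := by
  refine WithConv.ofConv_injective (LinearMap.ext fun x => ?_)
  change α x = 0
  induction x using DirectSum.Decomposition.inductionOn 𝓗 with
  | zero => exact map_zero _
  | homogeneous a => exact h _ _ (Nat.lt_succ_self _) a a.2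
  | add a b ha hb => rw [map_add, ha, hb, add_zero]

theorem compY_apply_one (𝓗 : ℕ → Submodule ℂ H) [GradedAlgebra 𝓗] (φ : LinMaps H) : compY 𝓗 φ 1 = 0 := by
  have h1 : (1 : H) ∈ 𝓗 0 := SetLike.GradedOne.one_mem
  have : gradY 𝓗 (1 : H) = 0 := by
    rw [gradY, gradedLift_apply 𝓗 _ h1]; simp
  change φ (gradY 𝓗 1) = 0
  rw [this, map_zero]

theorem mul_mem_van (𝓗 : ℕ → Submodule ℂ H) [GradedAlgebra 𝓗]
    [ConnectedGradedHopf 𝓗] {p q : ℕ} {α β : LinMaps H} (hα : α ∈ van 𝓗 p) (hβ : β ∈ van 𝓗 q) :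
    α * β ∈ van 𝓗 (p + q) := by
  intro n hn x hx
  have h := ConnectedGradedHopf.comul_mem n x hx
  have hle : (⨆ (p : ℕ × ℕ) (_ : p.1 + p.2 = n),
      LinearMap.range (TensorProduct.map (𝓗 p.1).subtype (𝓗 p.2).subtype)) ≤
      LinearMap.ker (LinearMap.mul' ℂ MeroGerm ∘ₗ TensorProduct.map α.ofConv β.ofConv) := by
    refine iSup₂_le fun ij hs => ?_
    rw [LinearMap.range_le_ker_iff]
    ext ⟨a, ha⟩ ⟨b, hb⟩
    simp only [TensorProduct.AlgebraTensorModule.curry_apply, TensorProduct.curry_apply,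
      LinearMap.coe_restrictScalars, LinearMap.comp_apply, TensorProduct.map_tmul,
      Submodule.subtype_apply, LinearMap.mul'_apply, LinearMap.zero_apply]
    rcases lt_or_ge ij.1 p with h1 | h1
    · rw [hα _ h1 a ha, zero_mul]
    · rw [hβ _ (by omega) b hb, mul_zero]
  exact hle h

theorem eq_smul_one (𝓗 : ℕ → Submodule ℂ H) [GradedAlgebra 𝓗]
    [ConnectedGradedHopf 𝓗] {x : H} (hx : x ∈ 𝓗 0) : ∃ c : ℂ, x = c • (1 : H) := by
  have h1 : (1 : H) ∈ 𝓗 0 := SetLike.GradedOne.one_mem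
  have hne : (⟨1, h1⟩ : 𝓗 0) ≠ 0 := by
    intro h
    have h0 : (1 : H) = 0 := congrArg Subtype.val h
    have : Subsingleton H := subsingleton_of_zero_eq_one h0.symm
    have hf := ConnectedGradedHopf.connected (𝓗 := 𝓗)
    rw [Module.finrank_zero_of_subsingleton] at hf
    exact zero_ne_one hf
  obtain ⟨c, hc⟩ := (finrank_eq_one_iff_of_nonzero' _ hne).mp
    (ConnectedGradedHopf.connected (𝓗 := 𝓗)) ⟨x, hx⟩
  exact ⟨c, (congrArg Subtype.val hc).symm⟩

theorem lieG_subset_van (𝓗 : ℕ → Submodule ℂ H) [GradedAlgebra 𝓗]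
    [ConnectedGradedHopf 𝓗] {α : LinMaps H} (hα : α ∈ lieG H) : α ∈ van 𝓗 1 := by
  intro n hn x hx
  obtain rfl : n = 0 := by omega
  obtain ⟨c, rfl⟩ := eq_smul_one 𝓗 hx
  rw [map_smul, show α 1 = 0 from hα, smul_zero]

theorem pow_mem_van (𝓗 : ℕ → Submodule ℂ H) [GradedAlgebra 𝓗]
    [ConnectedGradedHopf 𝓗] {α : LinMaps H} (hα : α ∈ lieG H) (k : ℕ) : α ^ k ∈ van 𝓗 k := by
  induction k with
  | zero => exact fun n hn => absurd hn (Nat.not_lt_zero n)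
  | succ k ih =>
    rw [pow_succ]
    exact mul_mem_van 𝓗 ih (lieG_subset_van 𝓗 hα)

theorem ring_aux_right {R : Type*} [Ring R] {a b s c : R} (h : a * s = 1 - c) :
    a * b - 1 = a * (b - s) - c := by
  rw [mul_sub, h]; abel

theorem ring_aux_left {R : Type*} [Ring R] {a b s c : R} (h : s * a = 1 - c) :
    b * a - 1 = (b - s) * a - c := by
  rw [sub_mul, h]; abel

/-- Elements of `G` are invertible for the convolution product. -/
theorem isUnit_of_mem_G (𝓗 : ℕ → Submodule ℂ H) [GradedAlgebra 𝓗]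
    [ConnectedGradedHopf 𝓗] {φ : LinMaps H} (hφ : φ ∈ G H) : IsUnit φ := by
  set α : LinMaps H := 1 - φ with hαdef
  have hα : α ∈ lieG H := mem_G_iff_sub.mp hφ
  let S : ℕ → LinMaps H := fun N => ∑ k ∈ Finset.range N, α ^ k
  let ψ : LinMaps H := WithConv.toConv (gradedLift 𝓗 fun n => (S (n + 1)).ofConv)
  have hψ : ∀ N, ψ - S N ∈ van 𝓗 N := by
    intro N n hn x hx
    have e1 : ψ x = S (n + 1) x := gradedLift_apply 𝓗 _ hx
    have e2 : S N - S (n + 1) ∈ van 𝓗 (n + 1) := by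
      have : S N - S (n + 1) = ∑ k ∈ Finset.Ico (n + 1) N, α ^ k :=
        (Finset.sum_Ico_eq_sub (fun k => α ^ k) (Nat.succ_le_of_lt hn)).symm
      rw [this]
      refine Submodule.sum_mem _ fun k hk m hm y hy => ?_
      exact pow_mem_van 𝓗 hα k m (lt_of_lt_of_le hm (Finset.mem_Ico.mp hk).1) y hy
    have e3 : S N x - S (n + 1) x = 0 := e2 n (Nat.lt_succ_self n) x hx
    change ψ x - S N x = 0
    rw [e1, ← neg_sub, e3, neg_zero]
  have hφα : φ = 1 - α := (sub_sub_cancel 1 φ).symm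
  have h0 : ∀ β : LinMaps H, β ∈ van 𝓗 0 := fun β n hn => absurd hn (Nat.not_lt_zero n)
  have hr : φ * ψ = 1 := by
    rw [← sub_eq_zero]
    refine eq_zero_of_mem_van 𝓗 fun N => ?_
    have h1 : φ * S N = 1 - α ^ N := by
      have := mul_neg_geom_sum α N
      rwa [← hφα] at this
    have h2 : φ * (ψ - S N) ∈ van 𝓗 N := by
      have := mul_mem_van 𝓗 (h0 φ) (hψ N)
      rwa [zero_add] at this
    have h3 : φ * (ψ - S N) - α ^ N ∈ van 𝓗 N := (van 𝓗 N).sub_mem h2 (pow_mem_van 𝓗 hα N)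
    have e : φ * ψ - 1 = φ * (ψ - S N) - α ^ N := ring_aux_right h1
    exact e ▸ h3
  have hl : ψ * φ = 1 := by
    rw [← sub_eq_zero]
    refine eq_zero_of_mem_van 𝓗 fun N => ?_
    have h1 : S N * φ = 1 - α ^ N := by
      have := geom_sum_mul_neg α N
      rwa [← hφα] at this
    have h2 : (ψ - S N) * φ ∈ van 𝓗 N := by
      have := mul_mem_van 𝓗 (hψ N) (h0 φ)
      rwa [add_zero] at this
    have h3 : (ψ - S N) * φ - α ^ N ∈ van 𝓗 N := (van 𝓗 N).sub_mem h2 (pow_mem_van 𝓗 hα N)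
    have e : ψ * φ - 1 = (ψ - S N) * φ - α ^ N := ring_aux_left h1
    exact e ▸ h3
  exact ⟨⟨φ, ψ, hr, hl⟩, rfl⟩

/-- For `φ ∈ G` the equation `φ ∘ Y = φ * γ` has exactly one solution `γ ∈ 𝔤`. -/
theorem existsUnique_renorm (𝓗 : ℕ → Submodule ℂ H) [GradedAlgebra 𝓗]
    [ConnectedGradedHopf 𝓗] (φ : G H) :
    ∃! γ : LinMaps H, γ ∈ lieG H ∧ compY 𝓗 φ = (φ : LinMaps H) * γ := by
  obtain ⟨u, hu⟩ := isUnit_of_mem_G 𝓗 φ.2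
  refine ⟨↑u⁻¹ * compY 𝓗 φ, ⟨?_, ?_⟩, ?_⟩
  · change (↑u⁻¹ * compY 𝓗 φ : LinMaps H) 1 = 0
    rw [mul_apply_one, compY_apply_one, mul_zero]
  · rw [← hu, Units.mul_inv_cancel_left]
  · rintro γ ⟨-, h⟩
    rw [h, ← hu, Units.inv_mul_cancel_left]

/-- `R̃ : G → 𝔤`, where `γ = R̃(φ)` is the solution of `φ ∘ Y = φ * γ`. -/
def renorm (𝓗 : ℕ → Submodule ℂ H) [GradedAlgebra 𝓗]
    [ConnectedGradedHopf 𝓗] (φ : G H) : LinMaps H := (existsUnique_renorm 𝓗 φ).choose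

theorem renorm_mem (𝓗 : ℕ → Submodule ℂ H) [GradedAlgebra 𝓗]
    [ConnectedGradedHopf 𝓗] (φ : G H) : renorm 𝓗 φ ∈ lieG H :=
  (existsUnique_renorm 𝓗 φ).choose_spec.1.1

theorem compY_eq (𝓗 : ℕ → Submodule ℂ H) [GradedAlgebra 𝓗]
    [ConnectedGradedHopf 𝓗] (φ : G H) : compY 𝓗 φ = (φ : LinMaps H) * renorm 𝓗 φ :=
  (existsUnique_renorm 𝓗 φ).choose_spec.1.2

end Hopf

end

end Renorm

namespace Renorm

/-! Write `γ` for `R̃(ψ)`. There are two separate points. Without any holomorphy condition, `R̃` is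
a bijection from `G` onto `𝔤`: in degree `n > 0`, the equation `ψ ∘ Y = ψ * γ` expresses `n ψ`
through values of `ψ` in lower degrees (`exists_compY_eq_mul`, `eq_of_compY_eq_mul`). Multiplication
by `z` is invertible on maps into `𝒜`. It remains to see that `ψ ∈ G^Φ` iff `zγ` is holomorphic. A
candidate polar part `m` serves every `t` iff all `m * ψᵗ` are holomorphic. Expanding `exp (tzn)`,
and using that each value has a pole of bounded order, `(m * ψᵗ)(x)` is modulo `𝒜₊` a polynomial in
`t` with coefficients `(m * zʲ(ψ ∘ Yʲ))(x) / j!` (`mul_twist_apply_sub_mem`). If `ψ ∈ G^Φ`, the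
coefficient of `t` shows that `(m * ψ) * zγ` is holomorphic, and `m * ψ` has a holomorphic inverse.
Conversely, if `zγ` is holomorphic, then `zʲ(ψ ∘ Yʲ) = ψ * β` with `β` holomorphic, so the polar
part of `ψ` works for all `t`. Uniqueness of the Birkhoff decomposition is not needed. -/

/-! ### Germs: Taylor expansions and polar parts. -/

theorem germOf_congr {f g : ℂ → ℂ} (hf : MeromorphicAt f 0) (hg : MeromorphicAt g 0)
    (h : f =ᶠ[𝓝[≠] 0] g) : germOf f hf = germOf g hg :=
  Subtype.ext (Germ.coe_eq.mpr h)

theorem germOf_mul {f g : ℂ → ℂ} (hf : MeromorphicAt f 0) (hg : MeromorphicAt g 0) :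
    germOf f hf * germOf g hg = germOf (f * g) (hf.mul hg) := rfl

theorem germOf_add {f g : ℂ → ℂ} (hf : MeromorphicAt f 0) (hg : MeromorphicAt g 0) :
    germOf f hf + germOf g hg = germOf (f + g) (hf.add hg) := rfl

theorem zGerm_pow (n : ℕ) :
    zGerm ^ n = germOf (fun z => z ^ n) ((MeromorphicAt.id (0 : ℂ)).pow n) := rfl

theorem smul_zGerm_pow (c : ℂ) (n : ℕ) :
    c • zGerm ^ n = germOf (fun z => c * z ^ n)
      ((MeromorphicAt.const c (0 : ℂ)).mul ((MeromorphicAt.id (0 : ℂ)).pow n)) := rfl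

theorem exists_eq_germOf (a : MeroGerm) : ∃ f hf, a = germOf f hf := by
  obtain ⟨_, f, hf, rfl⟩ := a
  exact ⟨f, hf, rfl⟩

theorem sum_smul_zGerm_pow (c : ℕ → ℂ) (N : ℕ) :
    ∃ h, ∑ j ∈ Finset.range N, c j • zGerm ^ j =
      germOf (fun z => ∑ j ∈ Finset.range N, c j * z ^ j) h := by
  induction N with
  | zero => exact ⟨by simp, by simp; rfl⟩
  | succ N ih =>
    obtain ⟨h, ih⟩ := ih
    refine ⟨?_, ?_⟩
    · simp only [Finset.sum_range_succ]
      exact h.add ((MeromorphicAt.const _ (0 : ℂ)).mul ((MeromorphicAt.id (0 : ℂ)).pow N))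
    · rw [Finset.sum_range_succ, ih, smul_zGerm_pow, germOf_add]
      exact germOf_congr _ _ (.of_forall fun z => by simp [Finset.sum_range_succ])

theorem zGerm_mem_holoAlg : zGerm ∈ holoAlg := ⟨_, analyticAt_id, rfl⟩

/-- The germ of `z ↦ z⁻¹`. -/
noncomputable def zInv : MeroGerm := germOf (fun z => z⁻¹) (MeromorphicAt.id 0).inv

theorem zInv_mul_zGerm : zInv * zGerm = 1 := by
  refine germOf_congr (g := fun _ => 1)
    ((MeromorphicAt.id (0 : ℂ)).inv.mul (MeromorphicAt.id 0)) (MeromorphicAt.const 1 0) ?_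
  filter_upwards [self_mem_nhdsWithin] with z hz
  exact inv_mul_cancel₀ hz

theorem zInv_pow_mul_zGerm_pow (n : ℕ) : zInv ^ n * zGerm ^ n = 1 := by
  rw [← mul_pow, zInv_mul_zGerm, one_pow]

theorem zInv_pow_succ_mem_polarAlg (n : ℕ) : zInv ^ (n + 1) ∈ polarAlg := by
  refine ⟨Polynomial.X ^ n, germOf_congr (f := fun z => z⁻¹ ^ (n + 1))
    ((MeromorphicAt.id (0 : ℂ)).inv.pow _) _ (.of_forall fun z => ?_)⟩
  simp [pow_succ']

/-- Taylor expansion of a holomorphic germ. -/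
theorem exists_taylor {f : ℂ → ℂ} (hf : AnalyticAt ℂ f 0) (N : ℕ) :
    ∃ r ∈ holoAlg, germOf f hf.meromorphicAt =
      ∑ j ∈ Finset.range N, (iteratedDeriv j f 0 / j.factorial) • zGerm ^ j + zGerm ^ N * r := by
  obtain ⟨F, hF, h⟩ := hf.exists_eq_sum_add_pow_mul N
  refine ⟨_, ⟨F, hF, rfl⟩, ?_⟩
  obtain ⟨h', e⟩ := sum_smul_zGerm_pow (fun j => iteratedDeriv j f 0 / j.factorial) N
  rw [e, zGerm_pow, germOf_mul, germOf_add]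
  refine germOf_congr _ _ (.of_forall fun z => ?_)
  simp only [Pi.add_apply, Pi.mul_apply]
  rw [h z]
  simp [div_eq_inv_mul, mul_assoc, mul_comm]

theorem expGerm_taylor (t : ℂ) (n N : ℕ) :
    ∃ r ∈ holoAlg, expGerm t n =
      ∑ j ∈ Finset.range N, (t ^ j / j.factorial * (n : ℂ) ^ j) • zGerm ^ j + zGerm ^ N * r := by
  obtain ⟨r, hr, e⟩ := exists_taylor (analyticAt_exp_mul t n) N
  refine ⟨r, hr, e.trans ?_⟩
  congr 1
  refine Finset.sum_congr rfl fun j _ => ?_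
  congr 1
  have : (fun z : ℂ => Complex.exp (t * z * n)) = fun z => Complex.exp ((t * n) * z) := by
    funext z; congr 1; ring
  rw [this, iteratedDeriv_cexp_const_mul]
  simp; ring

theorem expGerm_zero_left (n : ℕ) : expGerm 0 n = 1 :=
  germOf_congr (g := fun _ => 1) _ (MeromorphicAt.const 1 0) (.of_forall fun z => by simp)

theorem exists_zGerm_pow_mul_mem (a : MeroGerm) : ∃ N, zGerm ^ N * a ∈ holoAlg := by
  obtain ⟨f, hf, rfl⟩ := exists_eq_germOf a
  obtain ⟨n, hn⟩ := id hf
  refine ⟨n, _, hn, ?_⟩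
  rw [zGerm_pow, germOf_mul]
  exact germOf_congr _ _ (.of_forall fun z => by simp)

theorem zGerm_pow_mul_mem_of_le {a : MeroGerm} {N M : ℕ} (h : zGerm ^ N * a ∈ holoAlg)
    (hNM : N ≤ M) : zGerm ^ M * a ∈ holoAlg := by
  obtain ⟨k, rfl⟩ := Nat.exists_eq_add_of_le' hNM
  rw [pow_add, mul_assoc]
  exact mul_mem (pow_mem zGerm_mem_holoAlg k) h

/-- Induction on the pole order: the constant term `c` of `z^(N+1) a` is the leading coefficient,
and subtracting `c z^-(N+1)` lowers the order by one. -/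
theorem exists_polar_add_holo (a : MeroGerm) : ∃ p ∈ polarAlg, a - p ∈ holoAlg := by
  obtain ⟨N, hN⟩ := exists_zGerm_pow_mul_mem a
  induction N generalizing a with
  | zero => exact ⟨0, zero_mem _, by simpa using hN⟩
  | succ N ih =>
    obtain ⟨f, hf, e⟩ := hN
    obtain ⟨r, hr, e'⟩ := exists_taylor hf 1
    rw [← e] at e'
    simp only [Finset.range_one, Finset.sum_singleton, pow_zero, pow_one] at e'
    set c := iteratedDeriv 0 f 0 / (Nat.factorial 0 : ℂ)
    obtain ⟨p, hp, hp'⟩ := ih (a - c • zInv ^ (N + 1)) (by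
      have : zGerm ^ N * (a - c • zInv ^ (N + 1)) = r := by
        calc _ = (zInv * zGerm) * (zGerm ^ N * (a - c • zInv ^ (N + 1))) := by
              rw [zInv_mul_zGerm, one_mul]
          _ = zInv * (zGerm ^ (N + 1) * a - c • (zInv ^ (N + 1) * zGerm ^ (N + 1))) := by
              rw [mul_sub, mul_sub, mul_sub, mul_smul_comm, mul_smul_comm, mul_smul_comm]
              congr 1
              · ring
              · congr 1; ring
          _ = (zInv * zGerm) * r := by
              rw [e', zInv_pow_mul_zGerm_pow]; ring
          _ = r := by rw [zInv_mul_zGerm, one_mul]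
      rwa [this])
    refine ⟨p + c • zInv ^ (N + 1),
      add_mem hp (SMulMemClass.smul_mem c (zInv_pow_succ_mem_polarAlg N)), ?_⟩
    rwa [add_comm, ← sub_sub]

/-- A linear projection onto polar parts. -/
theorem exists_polar_projection :
    ∃ P : MeroGerm →ₗ[ℂ] MeroGerm, (∀ a, P a ∈ polarAlg) ∧ ∀ a, a - P a ∈ holoAlg := by
  let V := polarAlg.toSubmodule
  let W := Subalgebra.toSubmodule holoAlg
  -- A linear section of the sum map `𝒜₋ × 𝒜₊ → 𝒜` chooses polar parts linearly; only `𝒜 = 𝒜₋ + 𝒜₊`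
  -- is needed, not directness.
  obtain ⟨g, hg⟩ := LinearMap.exists_rightInverse_of_surjective (V.subtype.coprod W.subtype) <| by
    rw [LinearMap.range_eq_top]
    intro a
    obtain ⟨p, hp, h⟩ := exists_polar_add_holo a
    exact ⟨(⟨p, hp⟩, ⟨_, h⟩), add_sub_cancel p a⟩
  refine ⟨V.subtype ∘ₗ LinearMap.fst ℂ V W ∘ₗ g, fun a => (g a).1.2, fun a => ?_⟩
  have h : ((g a).1 : MeroGerm) + (g a).2 = a := LinearMap.congr_fun hg a
  have h2 : a - ((g a).1 : MeroGerm) = (g a).2 := sub_eq_of_eq_add' h.symm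
  exact h2.symm ▸ (g a).2.2

/-- A polynomial with coefficients in a vector space all of whose values lie in a subspace has
its coefficients there. -/
theorem mem_of_forall_sum_pow_smul_mem {V : Type*} [AddCommGroup V] [Module ℂ V]
    (W : Submodule ℂ V) {N : ℕ} (v : ℕ → V)
    (h : ∀ t : ℂ, ∑ j ∈ Finset.range N, t ^ j • v j ∈ W) {j : ℕ} (hj : j < N) : v j ∈ W := by
  -- In `V ⧸ W`, tested against each functional, the hypothesis says that a scalar polynomial
  -- vanishes identically.
  rw [← Submodule.Quotient.mk_eq_zero, ← Module.forall_dual_apply_eq_zero_iff ℂ]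
  intro f
  let p : Polynomial ℂ := ∑ j ∈ Finset.range N, Polynomial.monomial j (f (W.mkQ (v j)))
  have hp : p = 0 := by
    refine Polynomial.funext fun t => ?_
    have := congrArg f ((Submodule.Quotient.mk_eq_zero W).mpr (h t))
    rw [← Submodule.mkQ_apply] at this
    simp only [map_sum, map_smul, map_zero, smul_eq_mul] at this
    simpa [p, Polynomial.eval_finsetSum, mul_comm] using this
  have := congrArg (Polynomial.coeff · j) hp
  simpa [p, Polynomial.finsetSum_coeff, Polynomial.coeff_monomial, hj] using this

/-! ### Convolution: holomorphic maps and the degree filtration. -/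

section

variable {H : Type*} [Ring H] [HopfAlgebra ℂ H]

theorem mul_mem_holoMaps {a b : LinMaps H} (ha : a ∈ holoMaps H) (hb : b ∈ holoMaps H) :
    a * b ∈ holoMaps H := fun x => by
  rw [(ℛ ℂ x).convMul_apply]
  exact sum_mem fun i _ => mul_mem (ha _) (hb _)

theorem add_mem_holoMaps {a b : LinMaps H} (ha : a ∈ holoMaps H) (hb : b ∈ holoMaps H) :
    a + b ∈ holoMaps H := fun x => add_mem (ha x) (hb x)

theorem smul_mem_holoMaps {c : MeroGerm} {a : LinMaps H} (hc : c ∈ holoAlg)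
    (ha : a ∈ holoMaps H) : c • a ∈ holoMaps H := fun x => mul_mem hc (ha x)

theorem one_mem_holoMaps : (1 : LinMaps H) ∈ holoMaps H := fun x => by
  rw [LinearMap.convOne_apply]
  exact algebraMap_mem _ _

theorem pow_mem_holoMaps {a : LinMaps H} (ha : a ∈ holoMaps H) (n : ℕ) :
    a ^ n ∈ holoMaps H := by
  induction n with
  | zero => exact pow_zero a ▸ one_mem_holoMaps
  | succ n ih => exact pow_succ a n ▸ mul_mem_holoMaps ih ha

theorem sum_apply {ι : Type*} (s : Finset ι) (a : ι → LinMaps H) (x : H) :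
    (∑ i ∈ s, a i) x = ∑ i ∈ s, a i x := by
  classical
  induction s using Finset.induction_on with
  | empty => rfl
  | insert i s hi ih =>
    rw [Finset.sum_insert hi, Finset.sum_insert hi, ← ih]
    rfl

theorem sum_mem_holoMaps {ι : Type*} (s : Finset ι) {a : ι → LinMaps H}
    (ha : ∀ i, a i ∈ holoMaps H) : ∑ i ∈ s, a i ∈ holoMaps H := fun x =>
  sum_apply s a x ▸ sum_mem fun i _ => ha i x

variable (𝓗 : ℕ → Submodule ℂ H)

theorem van_antitone : Antitone (van 𝓗) := fun _ _ h _ ha n hn => ha n (hn.trans_le h)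

variable [GradedAlgebra 𝓗]

theorem ext_homogeneous {a b : LinMaps H} (h : ∀ n, ∀ x ∈ 𝓗 n, a x = b x) : a = b := by
  rw [← sub_eq_zero]
  exact eq_zero_of_mem_van 𝓗 fun N n _ x hx => sub_eq_zero.mpr (h n x hx)

theorem gradY_apply {n : ℕ} {x : H} (hx : x ∈ 𝓗 n) : gradY 𝓗 x = (n : ℂ) • x :=
  gradedLift_apply 𝓗 _ hx

theorem compY_apply (a : LinMaps H) {n : ℕ} {x : H} (hx : x ∈ 𝓗 n) :
    compY 𝓗 a x = (n : ℂ) • a x := by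
  change a (gradY 𝓗 x) = _
  rw [gradY_apply 𝓗 hx, map_smul]

theorem compY_iterate_apply (a : LinMaps H) {n : ℕ} {x : H} (hx : x ∈ 𝓗 n) (j : ℕ) :
    (compY 𝓗)^[j] a x = (n : ℂ) ^ j • a x := by
  induction j with
  | zero => simp
  | succ j ih => rw [Function.iterate_succ_apply', compY_apply 𝓗 _ hx, ih, smul_smul, pow_succ']

theorem compY_mem_holoMaps {a : LinMaps H} (ha : a ∈ holoMaps H) :
    compY 𝓗 a ∈ holoMaps H := fun _ => ha _

/-- In degree `n > 0` one divides by `n`; degree `0`, which `Y` kills, is covered by `h0`. -/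
theorem mem_van_succ_of_compY {a : LinMaps H} {N : ℕ} (h0 : a ∈ van 𝓗 1)
    (h : compY 𝓗 a ∈ van 𝓗 N) : a ∈ van 𝓗 N := fun n hn x hx => by
  rcases Nat.eq_zero_or_pos n with rfl | hpos
  · exact h0 0 one_pos x hx
  · have := h n hn x hx
    rw [compY_apply 𝓗 a hx] at this
    exact (smul_eq_zero.mp this).resolve_left (by exact_mod_cast hpos.ne')

/-- A contraction for the filtration `van` has a fixed point. -/
theorem exists_fixed_point (F : LinMaps H → LinMaps H)
    (hF : ∀ N a b, a - b ∈ van 𝓗 N → F a - F b ∈ van 𝓗 (N + 1)) : ∃ a, F a = a := by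
  let s : ℕ → LinMaps H := fun N => F^[N] 0
  have hs : ∀ N k, s (N + k) - s N ∈ van 𝓗 N := by
    intro N
    induction N with
    | zero => exact fun k n hn => absurd hn n.not_lt_zero
    | succ N ih =>
      intro k
      have e : ∀ M, s (M + 1) = F (s M) := fun M => Function.iterate_succ_apply' F M 0
      rw [Nat.add_right_comm, e, e]
      exact hF _ _ _ (ih k)
  -- From the `(n + 1)`-st on, all iterates agree in degree `n`, so this is their degreewise limit.
  let a : LinMaps H := WithConv.toConv (gradedLift 𝓗 fun n => (s (n + 1)).ofConv)
  have ha : ∀ N, a - s N ∈ van 𝓗 N := by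
    intro N n hn x hx
    have e1 : a x = s (n + 1) x := gradedLift_apply 𝓗 _ hx
    have e2 : s N x - s (n + 1) x = 0 := by
      obtain ⟨k, rfl⟩ := Nat.exists_eq_add_of_le (Nat.succ_le_of_lt hn)
      exact hs (n + 1) k n n.lt_succ_self x hx
    change a x - s N x = 0
    rw [e1, ← neg_sub, e2, neg_zero]
  refine ⟨a, sub_eq_zero.mp (eq_zero_of_mem_van 𝓗 fun N => ?_)⟩
  refine van_antitone 𝓗 N.le_succ ?_
  have h1 := hF N a (s N) (ha N)
  have h2 : a - F (s N) ∈ van 𝓗 (N + 1) := by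
    have := ha (N + 1)
    rwa [show s (N + 1) = F (s N) from Function.iterate_succ_apply' F N 0] at this
  exact sub_sub_sub_cancel_right (F a) a (F (s N)) ▸ (van 𝓗 (N + 1)).sub_mem h1 h2

/-! ### Consequences of the graded coproduct: Leibniz rule, Birkhoff decomposition, inversion of
`R̃`. -/

variable [ConnectedGradedHopf 𝓗]

/-- `φ ↦ φ ∘ Y` is a derivation for the convolution product. -/
theorem compY_mul (a b : LinMaps H) :
    compY 𝓗 (a * b) = compY 𝓗 a * b + a * compY 𝓗 b := by
  refine ext_homogeneous 𝓗 fun n x hx => ?_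
  rw [compY_apply 𝓗 _ hx]
  have h := ConnectedGradedHopf.comul_mem n x hx
  let L (u v : LinMaps H) : H ⊗[ℂ] H →ₗ[ℂ] MeroGerm :=
    LinearMap.mul' ℂ MeroGerm ∘ₗ TensorProduct.map u.ofConv v.ofConv
  -- The Leibniz rule is checked on `𝓗 p ⊗ 𝓗 q` with `p + q = n`, where it reads `n = p + q`; the
  -- coproduct of `x` lies in the span of these.
  have hle : (⨆ (p : ℕ × ℕ) (_ : p.1 + p.2 = n),
      LinearMap.range (TensorProduct.map (𝓗 p.1).subtype (𝓗 p.2).subtype)) ≤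
      LinearMap.eqLocus ((n : ℂ) • L a b) (L (compY 𝓗 a) b + L a (compY 𝓗 b)) := by
    refine iSup₂_le fun ij hs => ?_
    rintro _ ⟨w, rfl⟩
    induction w using TensorProduct.induction_on with
    | zero => rw [map_zero]; exact zero_mem _
    | add u v hu hv => rw [map_add]; exact add_mem hu hv
    | tmul u v =>
      obtain ⟨u, hu⟩ := u
      obtain ⟨v, hv⟩ := v
      have e1 := compY_apply 𝓗 a hu
      have e2 := compY_apply 𝓗 b hv
      change (n : ℂ) • (a u * b v) = compY 𝓗 a u * b v + a u * compY 𝓗 b v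
      rw [e1, e2, ← hs, smul_mul_assoc, mul_smul_comm, ← add_smul]
      push_cast
      rfl
  exact hle h

theorem compY_one : compY 𝓗 (1 : LinMaps H) = 0 := by
  have h := compY_mul 𝓗 (1 : LinMaps H) 1
  simpa using h

/-- With `α = 1 - a`, the inverse agrees in degree `n` with the geometric sum of the `αᵏ`, `k ≤ n`,
since `α^(n+1)` vanishes in degrees up to `n`. -/
theorem inverse_mem_holoMaps (𝓗 : ℕ → Submodule ℂ H) [GradedAlgebra 𝓗]
    [ConnectedGradedHopf 𝓗] {a : LinMaps H} (ha : a ∈ G H) (ha' : a ∈ holoMaps H) :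
    Ring.inverse a ∈ holoMaps H := by
  set α : LinMaps H := 1 - a with hα
  have hα' : α ∈ lieG H := mem_G_iff_sub.mp ha
  have hαh : α ∈ holoMaps H := fun x => sub_mem (one_mem_holoMaps x) (ha' x)
  have hu := isUnit_of_mem_G 𝓗 ha
  intro x
  induction x using DirectSum.Decomposition.inductionOn 𝓗 with
  | zero => exact (map_zero (Ring.inverse a).ofConv).symm ▸ zero_mem _
  | add u v hu hv => exact (map_add (Ring.inverse a).ofConv u v).symm ▸ add_mem hu hv
  | homogeneous x =>
    rename_i n
    have h1 : a * ∑ k ∈ Finset.range (n + 1), α ^ k = 1 - α ^ (n + 1) := by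
      have := mul_neg_geom_sum α (n + 1)
      rwa [show 1 - α = a by rw [hα, sub_sub_cancel]] at this
    have h2 : Ring.inverse a * α ^ (n + 1) =
        Ring.inverse a - ∑ k ∈ Finset.range (n + 1), α ^ k := by
      have := congrArg (Ring.inverse a * ·) h1
      simp only [← mul_assoc, Ring.inverse_mul_cancel a hu, one_mul, mul_sub, mul_one] at this
      rw [this, sub_sub_cancel]
    have h3 : Ring.inverse a * α ^ (n + 1) ∈ van 𝓗 (0 + (n + 1)) :=
      mul_mem_van 𝓗 (fun m hm => absurd hm m.not_lt_zero) (pow_mem_van 𝓗 hα' (n + 1))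
    rw [h2] at h3
    have h4 : Ring.inverse a x - (∑ k ∈ Finset.range (n + 1), α ^ k : LinMaps H) x = 0 :=
      h3 n (by omega) x x.2
    rw [sub_eq_zero.mp h4]
    exact sum_mem_holoMaps _ (fun k => pow_mem_holoMaps hαh k) x

/-- Existence of the Birkhoff decomposition. -/
theorem exists_birkhoff (𝓗 : ℕ → Submodule ℂ H) [GradedAlgebra 𝓗]
    [ConnectedGradedHopf 𝓗] {ψ : LinMaps H} (hψ : ψ ∈ G H) :
    ∃ m ∈ G H, (∀ x, counit (R := ℂ) x = 0 → m x ∈ polarAlg) ∧ m * ψ ∈ holoMaps H := by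
  obtain ⟨P, hP, hP'⟩ := exists_polar_projection
  have hα : ψ - 1 ∈ lieG H := by
    have h := mem_G_iff_sub.mp hψ
    change (ψ - 1) 1 = 0
    rw [← neg_sub]
    exact neg_eq_zero.mpr h
  -- Bogoliubov's recursion `m = 1 - P(m * (ψ - 1))`. It is a contraction because `ψ - 1` vanishes
  -- in degree `0`, and it gives `m * ψ = 1 + (id - P)(m * (ψ - 1))`.
  obtain ⟨m, hm⟩ := exists_fixed_point 𝓗
    (fun m => 1 - WithConv.toConv (P ∘ₗ (m * (ψ - 1)).ofConv)) (by
      intro N a b hab n hn x hx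
      have h : (a * (ψ - 1)) x - (b * (ψ - 1)) x = 0 := by
        have := mul_mem_van 𝓗 hab (lieG_subset_van 𝓗 hα) n hn x hx
        rwa [sub_mul] at this
      change ((1 : LinMaps H) x - P ((a * (ψ - 1)) x)) - ((1 : LinMaps H) x - P ((b * (ψ - 1)) x))
        = 0
      rw [sub_eq_zero.mp h, sub_self])
  have hmx : ∀ x, m x = (1 : LinMaps H) x - P ((m * (ψ - 1)) x) := fun x =>
    congrArg (fun a : LinMaps H => a x) hm.symm
  refine ⟨m, ?_, fun x hx => ?_, fun x => ?_⟩
  · change m 1 = 1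
    rw [hmx, mul_apply_one, show (ψ - 1) (1 : H) = 0 from hα, mul_zero, map_zero, sub_zero]
    simp
  · rw [hmx, LinearMap.convOne_apply, hx, map_zero, zero_sub]
    exact neg_mem (hP _)
  · have h : (m * ψ) x = (1 : LinMaps H) x + ((m * (ψ - 1)) x - P ((m * (ψ - 1)) x)) := by
      have e : m * ψ = m + m * (ψ - 1) := by rw [mul_sub, mul_one, add_sub_cancel]
      rw [e]
      change m x + (m * (ψ - 1)) x = _
      rw [hmx]
      abel
    rw [h]
    exact add_mem (one_mem_holoMaps x) (hP' _)

/-- Every `γ ∈ 𝔤` is the value of `R̃` at some element of `G`. -/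
theorem exists_compY_eq_mul {γ : LinMaps H} (hγ : γ ∈ lieG H) :
    ∃ ψ ∈ G H, compY 𝓗 ψ = ψ * γ := by
  -- `I` inverts `Y` in positive degrees and is zero in degree `0`, as `0⁻¹ = 0`. The equation
  -- becomes the fixed-point problem `ψ = 1 + (ψ * γ) ∘ I`.
  let I : H →ₗ[ℂ] H := gradedLift 𝓗 fun n => (n : ℂ)⁻¹ • LinearMap.id
  have hI : ∀ {n : ℕ} {x : H}, x ∈ 𝓗 n → I x = (n : ℂ)⁻¹ • x := fun hx => gradedLift_apply 𝓗 _ hx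
  obtain ⟨ψ, hψ⟩ := exists_fixed_point 𝓗
    (fun ψ => 1 + WithConv.toConv ((ψ * γ).ofConv ∘ₗ I)) (by
      intro N a b hab n hn x hx
      have h : (a * γ) x - (b * γ) x = 0 := by
        have := mul_mem_van 𝓗 hab (lieG_subset_van 𝓗 hγ) n hn x hx
        rwa [sub_mul] at this
      change ((1 : LinMaps H) x + (a * γ) (I x)) - ((1 : LinMaps H) x + (b * γ) (I x)) = 0
      rw [hI hx, map_smul, map_smul, sub_eq_zero.mp h, sub_self])
  have hψx : ∀ x, ψ x = (1 : LinMaps H) x + (ψ * γ) (I x) := fun x =>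
    congrArg (fun a : LinMaps H => a x) hψ.symm
  have hψγ : ψ * γ ∈ van 𝓗 1 := lieG_subset_van 𝓗 <| by
    change (ψ * γ) 1 = 0
    rw [mul_apply_one, show γ 1 = 0 from hγ, mul_zero]
  refine ⟨ψ, ?_, ext_homogeneous 𝓗 fun n x hx => ?_⟩
  · change ψ 1 = 1
    rw [hψx, hI (SetLike.GradedOne.one_mem : (1 : H) ∈ 𝓗 0)]
    simp
  · have h1 : (n : ℂ) • (1 : LinMaps H) x = 0 := by
      rw [← compY_apply 𝓗 _ hx, compY_one]
      rfl
    rw [compY_apply 𝓗 _ hx, hψx, smul_add, h1, zero_add, hI hx, map_smul, smul_smul]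
    rcases Nat.eq_zero_or_pos n with rfl | hpos
    · rw [hψγ 0 one_pos x hx, smul_zero]
    · rw [mul_inv_cancel₀ (by exact_mod_cast hpos.ne'), one_smul]

/-- The difference `δ` satisfies `δ ∘ Y = δ * γ`. Convolution with `γ` raises the filtration by one
and `Y` can be divided out, so `δ` vanishes in every degree. -/
theorem eq_of_compY_eq_mul {φ ψ γ : LinMaps H} (hφ : φ ∈ G H) (hψ : ψ ∈ G H) (hγ : γ ∈ lieG H)
    (h : compY 𝓗 φ = φ * γ) (h' : compY 𝓗 ψ = ψ * γ) : φ = ψ := by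
  have hd : φ - ψ ∈ van 𝓗 1 := lieG_subset_van 𝓗 <| by
    change φ 1 - ψ 1 = 0
    rw [show φ 1 = 1 from hφ, show ψ 1 = 1 from hψ, sub_self]
  have hY : compY 𝓗 (φ - ψ) = (φ - ψ) * γ := by
    rw [sub_mul, ← h, ← h']
    rfl
  rw [← sub_eq_zero]
  refine eq_zero_of_mem_van 𝓗 fun N => ?_
  induction N with
  | zero => exact fun n hn => absurd hn n.not_lt_zero
  | succ N ih =>
    exact mem_van_succ_of_compY 𝓗 hd (hY ▸ mul_mem_van 𝓗 ih (lieG_subset_van 𝓗 hγ))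

end

/-! ### Expansion of `ψᵗ` in powers of `t`. -/

section

variable {H : Type*} [Ring H] [HopfAlgebra ℂ H]
variable (𝓗 : ℕ → Submodule ℂ H) [GradedAlgebra 𝓗]

/-- The map given by `x ↦ r |x| ψ(x)` on homogeneous `x`. -/
noncomputable def degreeSMul (r : ℕ → MeroGerm) (ψ : LinMaps H) : LinMaps H :=
  WithConv.toConv (gradedLift 𝓗 fun n => r n • ψ.ofConv)

theorem degreeSMul_apply (r : ℕ → MeroGerm) (ψ : LinMaps H) {n : ℕ} {x : H} (hx : x ∈ 𝓗 n) :
    degreeSMul 𝓗 r ψ x = r n * ψ x :=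
  gradedLift_apply 𝓗 _ hx

/-- The order of the pole of `(φ * degreeSMul 𝓗 r ψ) x` is bounded uniformly in the holomorphic
coefficients `r`. -/
theorem exists_pole_bound (φ ψ : LinMaps H) (x : H) :
    ∃ N₀, ∀ N ≥ N₀, ∀ r : ℕ → MeroGerm, (∀ n, r n ∈ holoAlg) →
      zGerm ^ N * (φ * degreeSMul 𝓗 r ψ) x ∈ holoAlg := by
  -- On `a ⊗ b` with `b` homogeneous, `r` only contributes a holomorphic factor, so the pole is
  -- bounded by that of `φ a * ψ b`.
  suffices h : ∀ w : H ⊗[ℂ] H, ∃ N₀, ∀ N ≥ N₀, ∀ r : ℕ → MeroGerm, (∀ n, r n ∈ holoAlg) →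
      zGerm ^ N * LinearMap.mul' ℂ MeroGerm
        (TensorProduct.map φ.ofConv (degreeSMul 𝓗 r ψ).ofConv w) ∈ holoAlg from h (comul x)
  intro w
  induction w using TensorProduct.induction_on with
  | zero => exact ⟨0, fun N _ r _ => by simp⟩
  | add u v hu hv =>
    obtain ⟨N₁, h₁⟩ := hu
    obtain ⟨N₂, h₂⟩ := hv
    refine ⟨max N₁ N₂, fun N hN r hr => ?_⟩
    rw [map_add, map_add, mul_add]
    exact add_mem (h₁ N (le_of_max_le_left hN) r hr) (h₂ N (le_of_max_le_right hN) r hr)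
  | tmul a b =>
    simp only [TensorProduct.map_tmul, LinearMap.mul'_apply]
    induction b using DirectSum.Decomposition.inductionOn 𝓗 with
    | zero => exact ⟨0, fun N _ r _ => by simp⟩
    | add u v hu hv =>
      obtain ⟨N₁, h₁⟩ := hu
      obtain ⟨N₂, h₂⟩ := hv
      refine ⟨max N₁ N₂, fun N hN r hr => ?_⟩
      rw [map_add, mul_add, mul_add]
      exact add_mem (h₁ N (le_of_max_le_left hN) r hr) (h₂ N (le_of_max_le_right hN) r hr)
    | homogeneous b =>
      rename_i n
      obtain ⟨N₀, h⟩ := exists_zGerm_pow_mul_mem (φ a * ψ b)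
      refine ⟨N₀, fun N hN r hr => ?_⟩
      have e : (degreeSMul 𝓗 r ψ).ofConv b = r n * ψ b := degreeSMul_apply 𝓗 r ψ b.2
      have e' : zGerm ^ N * (φ a * (r n * ψ b)) = r n * (zGerm ^ N * (φ a * ψ b)) := by ring
      rw [e, e']
      exact mul_mem (hr n) (zGerm_pow_mul_mem_of_le h hN)

/-- Expansion of `ψᵗ` in powers of `t`. -/
theorem twist_expansion (t : ℂ) (N : ℕ) :
    ∃ r : ℕ → MeroGerm, (∀ n, r n ∈ holoAlg) ∧ ∀ ψ : LinMaps H,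
      twist 𝓗 t ψ = ∑ j ∈ Finset.range N,
        (t ^ j / j.factorial) • zGerm ^ j • (compY 𝓗)^[j] ψ + zGerm ^ N • degreeSMul 𝓗 r ψ := by
  choose r hr h using fun n => expGerm_taylor t n N
  refine ⟨r, hr, fun ψ => ext_homogeneous 𝓗 fun n x hx => ?_⟩
  have e1 : twist 𝓗 t ψ x = expGerm t n * ψ x := gradedLift_apply 𝓗 _ hx
  rw [e1, h n, add_mul, Finset.sum_mul]
  change _ = (∑ j ∈ Finset.range N,
    (t ^ j / j.factorial) • zGerm ^ j • (compY 𝓗)^[j] ψ : LinMaps H) x +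
      zGerm ^ N * degreeSMul 𝓗 r ψ x
  rw [sum_apply, degreeSMul_apply 𝓗 r ψ hx, mul_assoc]
  congr 1
  refine Finset.sum_congr rfl fun j _ => ?_
  change _ = (t ^ j / j.factorial : ℂ) • (zGerm ^ j * (compY 𝓗)^[j] ψ x)
  rw [compY_iterate_apply 𝓗 ψ hx, mul_smul_comm, smul_smul, smul_mul_assoc]

theorem twist_zero (ψ : LinMaps H) : twist 𝓗 0 ψ = ψ := by
  refine ext_homogeneous 𝓗 fun n x hx => ?_
  have e1 : twist 𝓗 0 ψ x = expGerm 0 n * ψ x := gradedLift_apply 𝓗 _ hx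
  rw [e1, expGerm_zero_left, one_mul]

/-- Modulo `𝒜₊`, the value of `φ * ψᵗ` at `x` is a polynomial in `t`. -/
theorem mul_twist_apply_sub_mem (φ ψ : LinMaps H) (x : H) :
    ∃ N₀, ∀ N ≥ N₀, ∀ t : ℂ, (φ * twist 𝓗 t ψ) x - ∑ j ∈ Finset.range N,
      t ^ j • ((1 / j.factorial : ℂ) • (φ * zGerm ^ j • (compY 𝓗)^[j] ψ) x) ∈ holoAlg := by
  -- The Taylor remainder depends on `t` only through `r`, and the bound is uniform in `r`; hence
  -- one `N₀` serves all `t`.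
  obtain ⟨N₀, h⟩ := exists_pole_bound 𝓗 φ ψ x
  refine ⟨N₀, fun N hN t => ?_⟩
  obtain ⟨r, hr, e⟩ := twist_expansion 𝓗 t N
  have : (φ * twist 𝓗 t ψ) x = ∑ j ∈ Finset.range N,
      t ^ j • ((1 / j.factorial : ℂ) • (φ * zGerm ^ j • (compY 𝓗)^[j] ψ) x) +
      zGerm ^ N * (φ * degreeSMul 𝓗 r ψ) x := by
    rw [e, mul_add, Finset.mul_sum]
    change (∑ j ∈ Finset.range N,
      φ * ((t ^ j / j.factorial : ℂ) • zGerm ^ j • (compY 𝓗)^[j] ψ) : LinMaps H) x +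
        (φ * zGerm ^ N • degreeSMul 𝓗 r ψ) x = _
    rw [sum_apply, mul_smul_comm]
    congr 1
    refine Finset.sum_congr rfl fun j _ => ?_
    rw [mul_smul_comm, smul_smul, mul_one_div]
    rfl
  rw [this, add_sub_cancel_left]
  exact h N hN r hr

/-! ### Independence of the polar part from `t` versus holomorphy of `zγ`. -/

variable [ConnectedGradedHopf 𝓗]

/-- Applying `z(· ∘ Y)` to `ψ * β` gives `ψ * (zγ * β + z(β ∘ Y))` by the Leibniz rule, and the new
right factor is again holomorphic. -/
theorem exists_holo_mul_eq_smul_iterate {ψ γ : LinMaps H} (h : compY 𝓗 ψ = ψ * γ)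
    (hγ : zGerm • γ ∈ holoMaps H) (j : ℕ) :
    ∃ β ∈ holoMaps H, zGerm ^ j • (compY 𝓗)^[j] ψ = ψ * β := by
  induction j with
  | zero => exact ⟨1, one_mem_holoMaps, by simp⟩
  | succ j ih =>
    obtain ⟨β, hβ, e⟩ := ih
    refine ⟨(zGerm • γ) * β + zGerm • compY 𝓗 β, add_mem_holoMaps (mul_mem_holoMaps hγ hβ)
      (smul_mem_holoMaps zGerm_mem_holoAlg (compY_mem_holoMaps 𝓗 hβ)), ?_⟩
    have e1 : zGerm ^ (j + 1) • (compY 𝓗)^[j + 1] ψ =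
        zGerm • compY 𝓗 (zGerm ^ j • (compY 𝓗)^[j] ψ) := by
      rw [Function.iterate_succ_apply', pow_succ', mul_smul]
      rfl
    rw [e1, e, compY_mul, h, mul_add, smul_add, mul_smul_comm, smul_mul_assoc, mul_smul_comm,
      mul_assoc]

/-- The common polar part `m` makes every `m * ψᵗ` holomorphic. The case `t = 0` gives `m * ψ`, the
coefficient of `t` gives `m * ψ * zγ`; cancel the former. -/
theorem holo_of_mem_GPhi {ψ γ : LinMaps H} (hψ : ψ ∈ GPhi 𝓗) (h : compY 𝓗 ψ = ψ * γ) :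
    zGerm • γ ∈ holoMaps H := by
  obtain ⟨hG, m, hm⟩ := hψ
  have hmG : m ∈ G H := (hm 0).choose_spec.1
  have hu := isUnit_of_mem_G 𝓗 hmG
  have hholo : ∀ t, m * twist 𝓗 t ψ ∈ holoMaps H := fun t => by
    obtain ⟨p, -, -, hp, e⟩ := hm t
    rw [e, Ring.mul_inverse_cancel_left m p hu]
    exact hp
  have h0 : m * ψ ∈ holoMaps H := by
    have := hholo 0
    rwa [twist_zero] at this
  have h0G : m * ψ ∈ G H := by
    change (m * ψ) 1 = 1
    rw [mul_apply_one, show m 1 = 1 from hmG, show ψ 1 = 1 from hG, mul_one]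
  have h1 : m * ψ * (zGerm • γ) ∈ holoMaps H := fun x => by
    obtain ⟨N₀, hN⟩ := mul_twist_apply_sub_mem 𝓗 m ψ x
    -- The length `N₀ + 2` is at least `N₀` and makes the index `1` available.
    have key := mem_of_forall_sum_pow_smul_mem (Subalgebra.toSubmodule holoAlg)
      (fun j => (1 / j.factorial : ℂ) • (m * zGerm ^ j • (compY 𝓗)^[j] ψ) x)
      (N := N₀ + 2) (fun t => by
        have := sub_mem (hholo t x) (hN (N₀ + 2) (by omega) t)
        rwa [sub_sub_cancel] at this) (show 1 < N₀ + 2 by omega)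
    have e : m * ψ * (zGerm • γ) = m * zGerm ^ 1 • (compY 𝓗)^[1] ψ := by
      rw [pow_one, Function.iterate_one, h, mul_smul_comm, mul_smul_comm, mul_assoc]
    rw [e]
    simpa using key
  have h2 := mul_mem_holoMaps (inverse_mem_holoMaps 𝓗 h0G h0) h1
  rwa [Ring.inverse_mul_cancel_left _ _ (isUnit_of_mem_G 𝓗 h0G)] at h2

/-- The polar part `m` of `ψ` itself works for all `t`: each coefficient of the expansion is a value
of `(m * ψ) * β` with both factors holomorphic. -/
theorem mem_GPhi_of_holo {ψ γ : LinMaps H} (hψ : ψ ∈ G H) (h : compY 𝓗 ψ = ψ * γ)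
    (hγ : zGerm • γ ∈ holoMaps H) : ψ ∈ GPhi 𝓗 := by
  obtain ⟨m, hmG, hm, hmψ⟩ := exists_birkhoff 𝓗 hψ
  refine ⟨hψ, m, fun t => ⟨m * twist 𝓗 t ψ, hmG, hm, fun x => ?_, ?_⟩⟩
  · obtain ⟨N, hN⟩ := mul_twist_apply_sub_mem 𝓗 m ψ x
    rw [← sub_add_cancel ((m * twist 𝓗 t ψ) x) (∑ j ∈ Finset.range N,
      t ^ j • ((1 / j.factorial : ℂ) • (m * zGerm ^ j • (compY 𝓗)^[j] ψ) x))]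
    refine add_mem (hN N le_rfl t) ?_
    refine sum_mem fun j _ => holoAlg.smul_mem (holoAlg.smul_mem ?_ _) _
    obtain ⟨β, hβ, e⟩ := exists_holo_mul_eq_smul_iterate 𝓗 h hγ j
    rw [e, ← mul_assoc]
    exact mul_mem_holoMaps hmψ hβ x
  · rw [Ring.inverse_mul_cancel_left _ _ (isUnit_of_mem_G 𝓗 hmG)]

end

end Renorm

/-! ### The bijection. -/

theorem mainTheorem3 {H : Type*} [Ring H] [HopfAlgebra ℂ H] (𝓗 : ℕ → Submodule ℂ H)
    [GradedAlgebra 𝓗] [Renorm.ConnectedGradedHopf 𝓗] :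
    Set.BijOn (fun ψ : Renorm.G H => Renorm.zGerm • Renorm.renorm 𝓗 ψ)
      {ψ : Renorm.G H | (ψ : Renorm.LinMaps H) ∈ Renorm.GPhi 𝓗}
      (Renorm.lieG H ∩ Renorm.holoMaps H) := by
  refine ⟨fun ψ hψ => ⟨?_, Renorm.holo_of_mem_GPhi 𝓗 hψ (Renorm.compY_eq 𝓗 ψ)⟩, ?_, ?_⟩
  · change Renorm.zGerm * Renorm.renorm 𝓗 ψ 1 = 0
    rw [show Renorm.renorm 𝓗 ψ 1 = 0 from Renorm.renorm_mem 𝓗 ψ, mul_zero]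
  · intro φ _ ψ _ h
    have h' : Renorm.renorm 𝓗 φ = Renorm.renorm 𝓗 ψ := by
      have := congrArg (Renorm.zInv • ·) h
      simpa only [smul_smul, Renorm.zInv_mul_zGerm, one_smul] using this
    exact Subtype.ext (Renorm.eq_of_compY_eq_mul 𝓗 φ.2 ψ.2 (Renorm.renorm_mem 𝓗 φ)
      (Renorm.compY_eq 𝓗 φ) (h' ▸ Renorm.compY_eq 𝓗 ψ))
  · rintro β ⟨hβ, hβ'⟩
    have hγ : Renorm.zInv • β ∈ Renorm.lieG H := by
      change Renorm.zInv * β 1 = 0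
      rw [show β 1 = 0 from hβ, mul_zero]
    have hz : Renorm.zGerm • Renorm.zInv • β = β := by
      rw [smul_smul, mul_comm, Renorm.zInv_mul_zGerm, one_smul]
    obtain ⟨ψ, hψ, e⟩ := Renorm.exists_compY_eq_mul 𝓗 hγ
    have hr : Renorm.renorm 𝓗 ⟨ψ, hψ⟩ = Renorm.zInv • β :=
      (Renorm.existsUnique_renorm 𝓗 ⟨ψ, hψ⟩).unique
        ⟨Renorm.renorm_mem 𝓗 _, Renorm.compY_eq 𝓗 _⟩ ⟨hγ, e⟩
    refine ⟨⟨ψ, hψ⟩, Renorm.mem_GPhi_of_holo 𝓗 hψ e (hz.symm ▸ hβ'), ?_⟩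
    change Renorm.zGerm • Renorm.renorm 𝓗 ⟨ψ, hψ⟩ = β
    rw [hr, hz]
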